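/- Let $1\to F\to G\xrightarrow{f}\mathbb{Z}\to 1$ be a short exact sequence of groups in which $F=\ker f$ is free of finite rank $n\ge 2$ (so $G$ is a (non-abelian finitely generated free)-by-$\mathbb{Z}$ group). Conventions. A left-order on a group $H$ is a strict total order $\prec$ such that $a\prec b\iff ca\prec cb$; its positive cone is $P_\prec=\{h : 1\prec h\}$. It is called regular (respectively one-counter) if there are a finite set $X$, a surjective monoid homomorphism $\pi:X^*\to H$ and a regular (respectively one-counter) language $\mathcal{L}\subseteq X^*$ with $\pi(\mathcal{L})=P_\prec$; a one-counter language is one accepted, by accepting states, by a non-deterministic pushdown automaton whose stack alphabet has exactly one letter (and which can detect that its stack is empty). A left-order on $G$ is lexicographic led by $\mathbb{Z}$ if its positive cone is $f^{-1}(P_{\mathbb{Z}})\cup P_F$, where $P_{\mathbb{Z}}$ and $P_F$ are the positive cones of left-orders on $\mathbb{Z}$ and on $F$. A subset of a finitely generated group is coarsely connected if, in the Cayley graph with respect to every finite generating set, some $R$-neighbourhood of it ($R>0$) is connected. Then: 1. No lexicographic left-order on $G$ led by $\mathbb{Z}$ is regular. 2. There is a lexicographic left-order $\prec$ on $G$ led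 by $\mathbb{Z}$ that is one-counter, whose positive cone is coarsely connected, and that extends to a regular left-order on $G\times\mathbb{Z}$; that is, there is a regular left-order $\prec'$ on $G\times\mathbb{Z}$ with $(a,0)\prec'(b,0)\iff a\prec b$ for all $a,b\in G$. -/

import Mathlib

universe u v

/-! ### Left-orders and lexicographic left-orders -/

/-- A left-order on a group: a strict total order invariant under left multiplication. -/
structure IsLeftOrder {G : Type u} [Group G] (lt : G → G → Prop) : Prop where
  irrefl : ∀ a, ¬ lt a a
  trans : ∀ a b c, lt a b → lt b c → lt a c
  total : ∀ a b, lt a b ∨ a = b ∨ lt b a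
  mul_left : ∀ a b c, lt a b ↔ lt (c * a) (c * b)

/-- The positive cone `{g | 1 < g}` of an order on a group. -/
def positiveCone {G : Type u} [Group G] (lt : G → G → Prop) : Set G :=
  {g | lt 1 g}

/-- For an epimorphism `f : G → Q` with kernel `N`, the left-order `lt` on `G` is lexicographic
led by the quotient `Q` if there are left-orders on `N` and `Q`, with positive cones `P_N` and
`P_Q`, such that the positive cone of `lt` is `f⁻¹(P_Q) ∪ P_N`. -/
def IsLexLedByQuotient {G : Type u} {Q : Type v} [Group G] [Group Q] (f : G →* Q)
    (lt : G → G → Prop) : Prop :=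
  IsLeftOrder lt ∧
    ∃ ltN : f.ker → f.ker → Prop, ∃ ltQ : Q → Q → Prop,
      IsLeftOrder ltN ∧ IsLeftOrder ltQ ∧
        positiveCone lt = f ⁻¹' positiveCone ltQ ∪ Subtype.val '' positiveCone ltN

/-- The order `lt'` on `G × H` extends the order `lt` on `G`, where `G` is identified with
`G × {1}`. -/
def ExtendsLeftFactor {G : Type u} {H : Type v} [Group G] [Group H]
    (lt' : G × H → G × H → Prop) (lt : G → G → Prop) : Prop :=
  ∀ a b : G, lt' (a, 1) (b, 1) ↔ lt a b

/-! ### Pushdown automata and one-counter languages -/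

/-- A (non-deterministic) pushdown automaton with input alphabet `X`, stack alphabet `Γ` and
states `S`. `trans s a c` lists the possible moves from the state `s` when the input read is `a`
(`none` means that no input letter is read) and the top of the stack is `c` (`none` means that the
stack is empty). Stack words are written with the top of the stack as the head of the list. -/
structure PushdownAutomaton (X : Type u) (Γ S : Type) where
  trans : S → Option X → Option Γ → Set (S × List Γ)
  finite_trans : ∀ s a c, (trans s a c).Finite
  start : S
  initStack : List Γ
  accept : Set S

namespace PushdownAutomaton

/-- One move between configurations (state, remaining input, stack): the automaton reads the input
letter `a` or nothing, removes the top letter of the stack (if there is one), and puts the word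
`v` on top of what remains. -/
def Step {X : Type u} {Γ S : Type} (M : PushdownAutomaton X Γ S)
    (c d : S × List X × List Γ) : Prop :=
  ∃ (a : Option X) (v : List Γ), c.2.1 = a.toList ++ d.2.1 ∧
    (d.1, v) ∈ M.trans c.1 a c.2.2.head? ∧ d.2.2 = v ++ c.2.2.tail

/-- The language accepted by a pushdown automaton, by accepting states and with any final stack. -/
def accepts {X : Type u} {Γ S : Type} (M : PushdownAutomaton X Γ S) : Language X :=
  {w | ∃ s ∈ M.accept, ∃ γ : List Γ,
    Relation.ReflTransGen M.Step (M.start, w, M.initStack) (s, [], γ)}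

end PushdownAutomaton

/-- A language is one-counter if it is accepted by a pushdown automaton with finitely many states
whose stack alphabet has exactly one letter. -/
def Language.IsOneCounter {X : Type u} (L : Language X) : Prop :=
  ∃ (Γ S : Type), Nat.card Γ = 1 ∧ Finite S ∧
    ∃ M : PushdownAutomaton X Γ S, M.accepts = L

/-! ### Subsets of groups represented by languages -/

/-- The evaluation of a word over the alphabet `X` in a group, given the values of the letters. -/
def evalWord {X : Type u} {G : Type v} [Group G] (x : X → G) (w : List X) : G :=
  (w.map x).prod

/-- `S` is the image, under evaluation, of a language of the class `C` over some finite alphabet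
`X` whose evaluation map `X* → G` is onto (a finite monoid generating set of `G`). -/
def IsRepresentedBy {G : Type u} [Group G] (C : ∀ {X : Type}, Language X → Prop)
    (S : Set G) : Prop :=
  ∃ (X : Type) (_ : Finite X) (x : X → G), Function.Surjective (evalWord x) ∧
    ∃ L : Language X, C L ∧ evalWord x '' L = S

/-- A left-order is regular if its positive cone is represented by a regular language. -/
def IsRegularLeftOrder {G : Type u} [Group G] (lt : G → G → Prop) : Prop :=
  IsLeftOrder lt ∧ IsRepresentedBy Language.IsRegular (positiveCone lt)

/-- A left-order is one-counter if its positive cone is represented by a one-counter language. -/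
def IsOneCounterLeftOrder {G : Type u} [Group G] (lt : G → G → Prop) : Prop :=
  IsLeftOrder lt ∧ IsRepresentedBy Language.IsOneCounter (positiveCone lt)

/-! ### Coarse connectedness -/

/-- A set `Y` of vertices of a graph is coarsely connected if, for some `R > 0`, the vertices at
distance at most `R` from `Y` span a connected subgraph. -/
def SimpleGraph.IsCoarselyConnected {V : Type u} (Γ : SimpleGraph V) (Y : Set V) : Prop :=
  ∃ R : ℕ, 0 < R ∧ (Γ.induce {v | ∃ y ∈ Y, Γ.edist v y ≤ R}).Connected

/-- A subset of a group is coarsely connected if it is so in the Cayley graph of the group with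
respect to every finite generating set. -/
def IsCoarselyConnectedSubset {G : Type u} [Group G] (P : Set G) : Prop :=
  ∀ S : Set G, S.Finite → Subgroup.closure S = ⊤ → (SimpleGraph.mulCayley S).IsCoarselyConnected P

/-! ### Cancellation in free groups -/

namespace FreeGroup

variable {α : Type*}

/-! Non-regularity comes from the tree structure of the free kernel `F`. If an automaton recognises
the cone, pumping completes every prefix of an accepted word with value in `F` by a short suffix to
another such word (`DFA.exists_short_suffix`). Hence such a word stays within finitely many heights
of the quotient, and its prefixes project to a path in `F` with bounded jumps, all of whose points
become positive after a correction from a finite set. Take `k ≺ g` with different first letters and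
`k` above a large finite set; an accepted word for `k⁻¹ g`, translated by `k`, gives a path from `k`
to `g`. It cannot enter a large ball about `1`, where the corrected points would lie below `k`, and
outside that ball bounded jumps cannot change the first letter.

For existence, `FreeGroup.weight` is an integer function on `F` with `weight g⁻¹ = -weight g`, odd
off `1`, and with `weight g + weight h ≤ weight (g * h) + 1`. Oddness and this defect bound make
`weight h + 2 * m > 0` a positive cone on `F × ℤ`, and putting the elements of positive image in
front gives `lexCone`. The weight is a sum over letters and adjacent pairs, so a central letter
emitted with each free letter can cancel its contribution: membership becomes a local condition and
the cone is regular. The cone on `G` is the slice of central coordinate `0`, which one counter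
detects. -/

theorem IsReduced.exists_cancellation {L₁ : List (α × Bool)} (h₁ : IsReduced L₁) :
    ∀ {L₂ : List (α × Bool)}, IsReduced L₂ →
      ∃ u w v, L₁ = u ++ w ∧ L₂ = invRev w ++ v ∧ IsReduced (u ++ v) := by
  induction L₁ using List.reverseRecOn with
  | nil => exact fun {L₂} h₂ => ⟨[], [], L₂, by simp [h₂]⟩
  | append_singleton L x ih =>
    intro L₂ h₂
    rcases L₂ with _ | ⟨y, L₂⟩
    · exact ⟨L ++ [x], [], [], by simp [h₁]⟩
    by_cases hxy : y = (x.1, !x.2)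
    · obtain ⟨u, w, v, rfl, rfl, h⟩ := ih (h₁.infix ⟨[], [x], by simp⟩)
        (h₂.infix ⟨[y], [], by simp⟩ : IsReduced L₂)
      exact ⟨u, w ++ [x], v, by simp [hxy, invRev, h]⟩
    · refine ⟨L ++ [x], [], y :: L₂, by simp, by simp, ?_⟩
      refine List.isChain_append.2 ⟨h₁, h₂, ?_⟩
      rintro a ha b hb h
      simp only [List.getLast?_append, List.getLast?_singleton, Option.some_or,
        Option.mem_def, Option.some.injEq, List.head?_cons] at ha hb
      subst ha hb
      by_contra h'
      exact hxy (Prod.ext h.symm (by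
        cases hx : x.2 <;> cases hy : y.2 <;> simp_all))

variable [DecidableEq α]

theorem exists_cancellation (g h : FreeGroup α) :
    ∃ u w v, g.toWord = u ++ w ∧ h.toWord = invRev w ++ v ∧ (g * h).toWord = u ++ v := by
  obtain ⟨u, w, v, h₁, h₂, h₃⟩ :=
    (isReduced_toWord (x := g)).exists_cancellation (isReduced_toWord (x := h))
  refine ⟨u, w, v, h₁, h₂, ?_⟩
  have : g * h = mk (u ++ v) := by
    rw [← mk_toWord (x := g), ← mk_toWord (x := h), h₁, h₂, ← mul_mk, ← mul_mk, ← mul_mk,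
      ← inv_mk]
    group
  rw [this, toWord_mk, h₃.reduce_eq]

/-- Too short to cancel all of `g`, the factor `h` leaves its first letter intact. This is how paths
with short steps far from `1` stay in one branch of the tree. -/
theorem head?_toWord_mul {g h : FreeGroup α} (hn : h.norm < g.norm) :
    (g * h).toWord.head? = g.toWord.head? := by
  obtain ⟨u, w, v, h₁, h₂, h₃⟩ := exists_cancellation g h
  have hu : u ≠ [] := by
    rintro rfl
    simp only [norm, h₁, h₂, List.nil_append, List.length_append, invRev_length] at hn
    omega
  rw [h₁, h₃, List.head?_append_of_ne_nil _ hu, List.head?_append_of_ne_nil _ hu]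

theorem finite_norm_le [Finite α] (D : ℕ) : {g : FreeGroup α | g.norm ≤ D}.Finite :=
  (List.finite_length_le (α × Bool) D).preimage toWord_injective.injOn

theorem head?_toWord_of_mul {g : FreeGroup α} {i : α} (h : ∀ b, g.toWord.head? ≠ some (i, b)) :
    (of i * g).toWord.head? = some (i, true) := by
  rw [toWord_mul, toWord_of, IsReduced.reduce_eq]
  · simp
  · refine List.isChain_append.2 ⟨List.isChain_singleton _, isReduced_toWord, ?_⟩
    rintro a ha b hb hab
    simp only [List.getLast?_singleton, Option.mem_def, Option.some.injEq] at ha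
    subst ha
    exact absurd hb (by
      rw [show b = (i, b.2) from Prod.ext hab.symm rfl]
      exact h _)

end FreeGroup

/-! ### An odd quasimorphism on a free group -/

namespace FreeGroup

variable {n : ℕ}

/-- The integer encoding a letter of a free group; inverse letters have opposite codes. -/
def letterCode (x : Fin n × Bool) : ℤ :=
  if x.2 then (x.1 : ℤ) + 1 else -((x.1 : ℤ) + 1)

theorem letterCode_ne_zero (x : Fin n × Bool) : letterCode x ≠ 0 := by
  unfold letterCode; split <;> omega

theorem letterCode_inv (x : Fin n × Bool) : letterCode (x.1, !x.2) = -letterCode x := by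
  rcases x with ⟨i, _ | _⟩ <;> simp [letterCode]

/-- Codes sum to zero only for mutually inverse letters, so each turn of a reduced word has sign
`±1`. -/
theorem letterCode_add_ne_zero {x y : Fin n × Bool} (h : x.1 = y.1 → x.2 = y.2) :
    letterCode x + letterCode y ≠ 0 := by
  rcases x with ⟨i, _ | _⟩ <;> rcases y with ⟨j, _ | _⟩ <;> simp [letterCode, Fin.ext_iff] at * <;>
    omega

/-- The sum of the signs of the letters of a word and of the signs of its turns. -/
def wordWeight : List (Fin n × Bool) → ℤ
  | [] => 0
  | [x] => (letterCode x).sign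
  | x :: y :: l =>
    (letterCode x).sign + (letterCode x + letterCode y).sign + wordWeight (y :: l)

/-- The sign of the turn between two consecutive words. -/
def turnSign (a b : Option (Fin n × Bool)) : ℤ :=
  match a, b with
  | some x, some y => (letterCode x + letterCode y).sign
  | _, _ => 0

theorem wordWeight_cons (x : Fin n × Bool) (l : List (Fin n × Bool)) :
    wordWeight (x :: l) = (letterCode x).sign + turnSign (some x) l.head? + wordWeight l := by
  cases l <;> simp [wordWeight, turnSign]

theorem wordWeight_append (l₁ l₂ : List (Fin n × Bool)) :
    wordWeight (l₁ ++ l₂) =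
      wordWeight l₁ + turnSign l₁.getLast? l₂.head? + wordWeight l₂ := by
  induction l₁ with
  | nil => simp [wordWeight, turnSign]
  | cons x l ih =>
    rcases l with _ | ⟨y, l⟩
    · simpa [wordWeight] using wordWeight_cons x l₂
    · rw [List.cons_append, wordWeight_cons, ih, wordWeight_cons x (y :: l)]
      simp only [List.cons_append, List.head?_cons, List.getLast?_cons_cons]
      ring

theorem wordWeight_invRev (l : List (Fin n × Bool)) :
    wordWeight (invRev l) = -wordWeight l := by
  induction l with
  | nil => simp [wordWeight]
  | cons x l ih =>
    have : invRev (x :: l) = invRev l ++ [(x.1, !x.2)] := by simp [invRev]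
    rw [this, wordWeight_append, ih, wordWeight_cons x l]
    have hl : (invRev l).getLast? = l.head?.map fun g => (g.1, !g.2) := by
      simp [invRev]
    rw [hl]
    cases l.head? with
    | none => simp [turnSign, wordWeight, letterCode_inv]
    | some y =>
      simp only [turnSign, wordWeight, letterCode_inv, Option.map_some, List.head?_cons,
        Int.sign_neg, ← neg_add, add_comm (letterCode y)]
      ring

theorem odd_sign {a : ℤ} (h : a ≠ 0) : Odd a.sign := by
  rcases h.lt_or_gt with h | h
  · rw [Int.sign_eq_neg_one_of_neg h]; decide
  · rw [Int.sign_eq_one_of_pos h]; decide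

/-- A reduced word with `k` letters has `k - 1` turns, so its weight is a sum of `2k - 1` signs
`±1`. -/
theorem IsReduced.odd_wordWeight {l : List (Fin n × Bool)} (h : IsReduced l) (hl : l ≠ []) :
    Odd (wordWeight l) := by
  induction l with
  | nil => exact absurd rfl hl
  | cons x l ih =>
    rcases l with _ | ⟨y, l⟩
    · exact odd_sign (letterCode_ne_zero x)
    · rw [isReduced_cons_cons] at h
      exact ((odd_sign (letterCode_ne_zero x)).add_odd
        (odd_sign (letterCode_add_ne_zero h.1))).add_odd (ih h.2 (by simp))

/-- The weight of the reduced word of an element of a free group. -/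
def weight (g : FreeGroup (Fin n)) : ℤ :=
  wordWeight g.toWord

@[simp]
theorem weight_one : weight (1 : FreeGroup (Fin n)) = 0 := by
  simp [weight, wordWeight]

theorem weight_inv (g : FreeGroup (Fin n)) : weight g⁻¹ = -weight g := by
  rw [weight, toWord_inv, wordWeight_invRev, weight]

theorem odd_weight {g : FreeGroup (Fin n)} (h : g ≠ 1) : Odd (weight g) :=
  isReduced_toWord.odd_wordWeight (by simpa using h)

theorem sign_cases (a : ℤ) : a < 0 ∧ a.sign = -1 ∨ a = 0 ∧ a.sign = 0 ∨ 0 < a ∧ a.sign = 1 := by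
  rcases lt_trichotomy a 0 with h | h | h
  · exact .inl ⟨h, Int.sign_eq_neg_one_of_neg h⟩
  · exact .inr (.inl ⟨h, by simp [h]⟩)
  · exact .inr (.inr ⟨h, Int.sign_eq_one_of_pos h⟩)

theorem le_sign_add (a b : ℤ) : a.sign + b.sign ≤ (a + b).sign + 1 := by
  have := sign_cases a
  have := sign_cases b
  have := sign_cases (a + b)
  omega

/-- The cancelled parts have opposite weights, so only the turns at the junction matter. Their codes
telescope, `(p + q) + (-q + r) = p + r`, and `le_sign_add` bounds the defect. -/
theorem weight_add_le (g h : FreeGroup (Fin n)) : weight g + weight h ≤ weight (g * h) + 1 := by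
  obtain ⟨u, w, v, h₁, h₂, h₃⟩ := exists_cancellation g h
  rw [weight, weight, weight, h₁, h₂, h₃, wordWeight_append, wordWeight_append,
    wordWeight_append, wordWeight_invRev]
  suffices turnSign u.getLast? w.head? + turnSign (invRev w).getLast? v.head? ≤
      turnSign u.getLast? v.head? + 1 by linarith
  have hl : (invRev w).getLast? = w.head?.map fun g => (g.1, !g.2) := by simp [invRev]
  rw [hl]
  rcases u.getLast? with _ | p <;> rcases w.head? with _ | q <;> rcases v.head? with _ | r
  case some.some.some =>
    have := le_sign_add (letterCode p + letterCode q) (-letterCode q + letterCode r)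
    rw [show letterCode p + letterCode q + (-letterCode q + letterCode r) =
      letterCode p + letterCode r by ring] at this
    simpa [turnSign, letterCode_inv] using this
  case none.some.some =>
    have := sign_cases (-letterCode q + letterCode r)
    simp only [turnSign, letterCode_inv, Option.map_some]
    omega
  case some.some.none =>
    have := sign_cases (letterCode p + letterCode q)
    simp only [turnSign, Option.map_some]
    omega
  case some.none.some =>
    have := sign_cases (letterCode p + letterCode r)
    simp only [turnSign, Option.map_none]
    omega
  all_goals simp [turnSign]

end FreeGroup

/-! ### Left-orders on free groups and regular languages -/

namespace IsLeftOrder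

variable {G : Type u} [Group G] {lt : G → G → Prop}

theorem comap {H : Type v} [Group H] (h : IsLeftOrder lt) {ψ : H →* G}
    (hψ : Function.Injective ψ) : IsLeftOrder fun a b => lt (ψ a) (ψ b) where
  irrefl a := h.irrefl _
  trans a b c := h.trans _ _ _
  total a b := by simpa [hψ.eq_iff] using h.total (ψ a) (ψ b)
  mul_left a b c := by simpa using h.mul_left (ψ a) (ψ b) (ψ c)

theorem exists_forall_lt [Nontrivial G] (h : IsLeftOrder lt) {A : Set G} (hA : A.Finite) :
    ∃ g, ∀ a ∈ A, lt a g := by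
  obtain ⟨p, hp⟩ : ∃ p, lt 1 p := by
    obtain ⟨g, hg⟩ := exists_ne (1 : G)
    rcases h.total 1 g with h' | h' | h'
    · exact ⟨g, h'⟩
    · exact absurd h'.symm hg
    · exact ⟨g⁻¹, by simpa using (h.mul_left g 1 g⁻¹).1 h'⟩
  induction A, hA using Set.Finite.induction_on with
  | empty => exact ⟨1, by simp⟩
  | @insert a A _ _ ih =>
    obtain ⟨g, hg⟩ := ih
    have hap : lt a (a * p) := by simpa using (h.mul_left 1 p a).1 hp
    rcases h.total a g with h' | rfl | h'
    · exact ⟨g, by simpa [h'] using hg⟩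
    · exact ⟨a * p, by simpa [hap] using fun b hb => h.trans _ _ _ (hg b hb) hap⟩
    · exact ⟨a * p, by
        simpa [hap] using fun b hb => h.trans _ _ _ (h.trans _ _ _ (hg b hb) h') hap⟩

/-- In a left-ordered free group, every finite set has two strict upper bounds, one smaller than
the other, whose reduced words begin with different letters. -/
theorem exists_upper_bounds_head?_ne {n : ℕ} (hn : 2 ≤ n)
    {lt : FreeGroup (Fin n) → FreeGroup (Fin n) → Prop} (h : IsLeftOrder lt)
    {A : Set (FreeGroup (Fin n))} (hA : A.Finite) :
    ∃ k g, (∀ a ∈ A, lt a k) ∧ lt k g ∧ k.toWord.head? ≠ g.toWord.head? := by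
  have : Nontrivial (Fin n) := Fin.nontrivial_iff_two_le.2 hn
  have : Nontrivial (FreeGroup (Fin n)) :=
    ⟨1, FreeGroup.of ⟨0, by omega⟩, FreeGroup.one_ne_of _⟩
  -- Bounding the translates `i⁻¹A` as well ensures that `i * g` is also above `A`. For `i`
  -- different from the generator that starts `g`, the two bounds have different first letters.
  obtain ⟨g, hg⟩ := h.exists_forall_lt
    (hA.union (Set.finite_iUnion fun i => hA.image fun a => (FreeGroup.of i)⁻¹ * a))
  obtain ⟨i, hi⟩ : ∃ i, ∀ b, g.toWord.head? ≠ some (i, b) := by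
    rcases g.toWord.head? with _ | ⟨j, b⟩
    · exact ⟨⟨0, by omega⟩, by simp⟩
    · obtain ⟨i, hi⟩ := exists_ne j
      exact ⟨i, fun b => by simp [hi.symm]⟩
  have hne : (FreeGroup.of i * g).toWord.head? ≠ g.toWord.head? := by
    rw [FreeGroup.head?_toWord_of_mul hi]
    exact (hi true).symm
  have h₁ : ∀ a ∈ A, lt a g := fun a ha => hg a (.inl ha)
  have h₂ : ∀ a ∈ A, lt a (FreeGroup.of i * g) := fun a ha => by
    simpa using (h.mul_left _ _ (FreeGroup.of i)).1
      (hg ((FreeGroup.of i)⁻¹ * a) (.inr (Set.mem_iUnion.2 ⟨i, a, ha, rfl⟩)))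
  rcases h.total g (FreeGroup.of i * g) with h' | h' | h'
  · exact ⟨g, _, h₁, h', hne.symm⟩
  · exact absurd (by rw [← h']) hne
  · exact ⟨_, g, h₂, h', hne⟩

end IsLeftOrder

section EvalWord

variable {X : Type u} {G : Type v} [Group G] (x : X → G)

@[simp]
theorem evalWord_nil : evalWord x [] = 1 := rfl

@[simp]
theorem evalWord_cons (a : X) (w : List X) : evalWord x (a :: w) = x a * evalWord x w := by
  simp [evalWord]

@[simp]
theorem evalWord_append (w₁ w₂ : List X) :
    evalWord x (w₁ ++ w₂) = evalWord x w₁ * evalWord x w₂ := by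
  simp [evalWord]

theorem map_evalWord {H : Type*} [Group H] (φ : G →* H) (w : List X) :
    φ (evalWord x w) = evalWord (φ ∘ x) w := by
  simp [evalWord, map_list_prod]

end EvalWord

/-- If a homomorphism sends the elements represented by the language of a finite automaton into a
cone without inverses, then suffixes of words of trivial image can be shortened. -/
theorem DFA.exists_short_suffix {X : Type u} {σ : Type*} [Fintype σ] (M : DFA X σ) {Q : Type v}
    [Group Q] (y : X → Q) (hpos : ∀ w ∈ M.accepts, ∀ w' ∈ M.accepts, evalWord y w * evalWord y w' = 1 →
      evalWord y w = 1) (u s : List X) (hus : u ++ s ∈ M.accepts)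
    (h1 : evalWord y (u ++ s) = 1) :
    ∃ v, v.length < Fintype.card σ ∧ u ++ v ∈ M.accepts ∧ evalWord y (u ++ v) = 1 := by
  induction hN : s.length using Nat.strong_induction_on generalizing s with
  | _ N ih =>
    subst hN
    rcases lt_or_ge s.length (Fintype.card σ) with hs | hs
    · exact ⟨s, hs, hus, h1⟩
    obtain ⟨q, a, b, c, rfl, -, hb, hqa, hqb, hqc⟩ :=
      M.evalFrom_split (s := M.eval u) hs rfl
    have key : ∀ l, M.evalFrom q l = q → u ++ (a ++ l ++ c) ∈ M.accepts := fun l hl => by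
      rw [DFA.mem_accepts, DFA.eval, DFA.evalFrom_of_append, DFA.evalFrom_of_append,
        DFA.evalFrom_of_append]
      rw [DFA.mem_accepts, DFA.eval, DFA.evalFrom_of_append, ← DFA.eval, ← hqc] at hus
      rwa [← DFA.eval, hqa, hl]
    -- Delete the loop `b`, and also double it: since `u a b c` has value `1`, the two resulting
    -- values are mutually inverse, so `hpos` makes the shorter word trivial.
    have h₁ := key [] rfl
    have h₂ := key (b ++ b) (by rw [DFA.evalFrom_of_append, hqb, hqb])
    have hv : evalWord y (u ++ (a ++ [] ++ c)) = 1 := by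
      refine hpos _ h₁ _ h₂ ?_
      simp only [evalWord_append, evalWord_nil, mul_one] at h1 ⊢
      have hb' : evalWord y b = (evalWord y a)⁻¹ * (evalWord y u)⁻¹ * (evalWord y c)⁻¹ :=
        calc evalWord y b = (evalWord y a)⁻¹ * (evalWord y u)⁻¹ *
              (evalWord y u * (evalWord y a * evalWord y b * evalWord y c)) *
              (evalWord y c)⁻¹ := by group
          _ = _ := by rw [h1, mul_one]
      rw [hb']
      group
    exact ih _ (by
      have := List.length_pos_iff.2 hb
      simp; omega) _ h₁ hv rfl

/-- A lexicographic left-order led by a quotient is not regular if the kernel is free of rank at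
least two. -/
theorem IsLexLedByQuotient.not_isRegularLeftOrder {G : Type u} {Q : Type v} [Group G] [Group Q]
    {f : G →* Q} (hf : Function.Surjective f) {n : ℕ} (hn : 2 ≤ n)
    (e : f.ker ≃* FreeGroup (Fin n)) {lt : G → G → Prop} (hlex : IsLexLedByQuotient f lt) :
    ¬ IsRegularLeftOrder lt := by
  rintro ⟨hlt, X, _, x, -, L, ⟨σ, _, M, rfl⟩, hL⟩
  obtain ⟨-, ltN, ltQ, -, hQ, hP⟩ := hlex
  let ψ : FreeGroup (Fin n) →* G := f.ker.subtype.comp e.symm.toMonoidHom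
  have hψ : Function.Injective ψ := f.ker.subtype_injective.comp e.symm.injective
  have hψf : ∀ a, f (ψ a) = 1 := fun a => (e.symm a).2
  have hψr : ∀ g, f g = 1 → ∃ a, ψ a = g := fun g hg =>
    ⟨e ⟨g, hg⟩, by simp [ψ]⟩
  have hF := hlt.comap hψ
  -- A set-theoretic section suffices; normalising it at `1` makes the projected path start at `1`
  -- and end at the value of the word.
  obtain ⟨s, hs, hs1⟩ : ∃ s : Q → G, (∀ q, f (s q) = q) ∧ s 1 = 1 := by
    refine ⟨fun q => Function.surjInv hf q * (Function.surjInv hf 1)⁻¹, fun q => ?_, by simp⟩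
    simp [Function.surjInv_eq hf]
  have hmem : ∀ g, (∃ w ∈ M.accepts, evalWord x w = g) ↔ lt 1 g := fun g => by
    change g ∈ evalWord x '' M.accepts ↔ g ∈ positiveCone lt
    rw [hL]
  have hval : ∀ w ∈ M.accepts, ltQ 1 (evalWord (f ∘ x) w) ∨ evalWord (f ∘ x) w = 1 := by
    intro w hw
    rw [← map_evalWord]
    have : evalWord x w ∈ positiveCone lt := (hmem _).1 ⟨w, hw, rfl⟩
    rw [hP] at this
    rcases this with h | ⟨a, -, ha⟩
    · exact .inl h
    · exact .inr (ha ▸ a.2)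
  have hshort := M.exists_short_suffix (f ∘ x) fun w hw w' hw' h => by
    rcases hval w hw with h₁ | h₁
    · rcases hval w' hw' with h₂ | h₂
      · have := hQ.trans _ _ _ h₁ (by simpa using (hQ.mul_left _ _ (evalWord (f ∘ x) w)).1 h₂)
        exact absurd (h ▸ this) (hQ.irrefl 1)
      · simpa [h₂] using h
    · exact h₁
  -- `V`, `H`, `C`, `E`: suffixes, heights, completions and steps
  set V : Set (List X) := {v | v.length < Fintype.card σ} with hV
  have hVfin : V.Finite := List.finite_length_lt X _
  set H : Set Q := (fun v => (evalWord (f ∘ x) v)⁻¹) '' V with hH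
  have hHfin : H.Finite := hVfin.image _
  set C : Set (FreeGroup (Fin n)) :=
    ψ ⁻¹' Set.image2 (fun q v => s q * evalWord x v) H V with hC
  have hCfin : C.Finite := (hHfin.image2 _ hVfin).preimage hψ.injOn
  set E : Set (FreeGroup (Fin n)) :=
    ψ ⁻¹' Set.image2 (fun g q => g * (s q)⁻¹) (Set.image2 (fun q a => s q * x a) H Set.univ) H
    with hE
  have hEfin : E.Finite :=
    (((hHfin.image2 _ Set.finite_univ).image2 _ hHfin)).preimage hψ.injOn
  obtain ⟨D, hD⟩ := (hEfin.image FreeGroup.norm).bddAbove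
  -- `D` bounds the jumps of the projected path and `C` contains the corrections; `k` is chosen
  -- above the ball of radius `D` times `C`.
  obtain ⟨k, g, hk, hkg, hne⟩ := hF.exists_upper_bounds_head?_ne hn
    (((FreeGroup.finite_norm_le D).image2 (fun b c => b * c) hCfin))
  obtain ⟨w, hw, hwp⟩ := (hmem (ψ (k⁻¹ * g))).2 (by
    simpa using (hlt.mul_left (ψ k) (ψ g) (ψ k⁻¹)).1 hkg)
  choose q hq using fun l : List X => hψr (evalWord x l * (s (f (evalWord x l)))⁻¹) (by simp [hs])
  have hcomp : ∀ l, l <+: w → ∃ v ∈ V, l ++ v ∈ M.accepts ∧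
      f (evalWord x l) = (evalWord (f ∘ x) v)⁻¹ := by
    rintro l ⟨r, rfl⟩
    obtain ⟨v, hv, hv', h1⟩ := hshort l r hw (by rw [← map_evalWord, hwp, hψf])
    refine ⟨v, hv, hv', ?_⟩
    rwa [evalWord_append, mul_eq_one_iff_eq_inv, ← map_evalWord x] at h1
  have hheight : ∀ l, l <+: w → f (evalWord x l) ∈ H := fun l hl => by
    obtain ⟨v, hv, -, h⟩ := hcomp l hl
    exact ⟨v, hv, h.symm⟩
  -- A completion `c ∈ C` makes `q l * c` positive, hence `k ≺ k * q l * c`; a point `k * q l` in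
  -- the ball would give the opposite inequality.
  have hfar : ∀ l, l <+: w → D < (k * q l).norm := by
    intro l hl
    by_contra! hle
    obtain ⟨v, hv, hv', h⟩ := hcomp l hl
    obtain ⟨c, hc⟩ := hψr (s (f (evalWord x l)) * evalWord x v) (by
      rw [map_mul, hs, h, map_evalWord, inv_mul_cancel])
    have h₁ := hk _ ⟨k * q l, hle, c, ⟨_, hheight l hl, v, hv, hc.symm⟩, rfl⟩
    have h₂ := (hmem _).1 ⟨_, hv', rfl⟩
    have h₃ : ψ (q l * c) = evalWord x (l ++ v) := by
      rw [map_mul, hq, hc, evalWord_append]; group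
    rw [← h₃, hlt.mul_left _ _ (ψ k), mul_one, ← map_mul, ← mul_assoc] at h₂
    exact hF.irrefl _ (hF.trans _ _ _ h₂ h₁)
  have hq1 : q [] = 1 := hψ (by simp [hq, hs1])
  have hqw : k * q w = g := hψ (by simp [hq, hwp, hψf, hs1])
  have hhead : ∀ l, l <+: w → (k * q l).toWord.head? = k.toWord.head? := by
    intro l
    induction l using List.reverseRecOn with
    | nil => simp [hq1]
    | append_singleton l a ih =>
      intro hl
      have hl' : l <+: w := (List.prefix_append l [a]).trans hl
      rw [← ih hl', show k * q (l ++ [a]) = k * q l * ((q l)⁻¹ * q (l ++ [a])) by group]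
      refine FreeGroup.head?_toWord_mul (lt_of_le_of_lt (hD ⟨_, ?_, rfl⟩) (hfar l hl'))
      refine ⟨_, ⟨_, hheight l hl', a, trivial, rfl⟩, _, hheight _ hl, ?_⟩
      simp only [map_mul, map_inv, hq, evalWord_append, evalWord_cons, evalWord_nil]
      group
  exact hne (by rw [← hhead w (List.prefix_refl w), hqw])

/-! ### Local languages and counters -/

/-- The language of nonempty words whose first letter satisfies `I` and whose consecutive letters
are related by `R`. -/
def localLanguage {X : Type u} (I : X → Prop) (R : X → X → Prop) : Language X :=
  {w | (∃ a ∈ w.head?, I a) ∧ w.IsChain R}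

open Classical in
/-- The automaton of a local language; it remembers the last letter read, and `some none` is the
failure state. -/
noncomputable def localDFA {X : Type u} (I : X → Prop) (R : X → X → Prop) :
    DFA X (Option (Option X)) where
  step s a := match s with
    | none => if I a then some (some a) else some none
    | some none => some none
    | some (some b) => if R b a then some (some a) else some none
  start := none
  accept := {s | ∃ a, s = some (some a)}

theorem localDFA_evalFrom_fail {X : Type u} (I : X → Prop) (R : X → X → Prop) (w : List X) :
    (localDFA I R).evalFrom (some none) w = some none := by
  induction w with
  | nil => rfl
  | cons a w ih => exact ih

theorem localDFA_evalFrom_mem {X : Type u} (I : X → Prop) (R : X → X → Prop) (w : List X) (b : X) :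
    (localDFA I R).evalFrom (some (some b)) w ∈ (localDFA I R).accept ↔ (b :: w).IsChain R := by
  induction w generalizing b with
  | nil => simp [localDFA]
  | cons a w ih =>
    rw [List.isChain_cons_cons, DFA.evalFrom_cons]
    by_cases h : R b a
    · rw [← ih a]; simp [localDFA, h]
    · have : (localDFA I R).step (some (some b)) a = some none := by simp [localDFA, h]
      rw [this, localDFA_evalFrom_fail]
      simp [localDFA, h]

theorem localDFA_accepts {X : Type u} (I : X → Prop) (R : X → X → Prop) :
    (localDFA I R).accepts = localLanguage I R := by
  ext w
  change _ ↔ (∃ a ∈ w.head?, I a) ∧ w.IsChain R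
  rw [DFA.mem_accepts, DFA.eval]
  rcases w with _ | ⟨a, w⟩
  · simp [localDFA]
  rw [DFA.evalFrom_cons]
  by_cases h : I a
  · rw [show (localDFA I R).step (localDFA I R).start a = some (some a) by simp [localDFA, h],
      localDFA_evalFrom_mem]
    simp [h]
  · rw [show (localDFA I R).step (localDFA I R).start a = some none by simp [localDFA, h],
      localDFA_evalFrom_fail]
    simp [h, localDFA]

theorem isRegular_localLanguage {X : Type} [Finite X] (I : X → Prop) (R : X → X → Prop) :
    (localLanguage I R).IsRegular := by
  have := Fintype.ofFinite X
  exact ⟨_, inferInstance, localDFA I R, localDFA_accepts I R⟩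

/-- The integer of sign `b` (`true` for nonnegative) and absolute value `k`. -/
def signedValue (b : Bool) (k : ℕ) : ℤ :=
  if b then k else -k

/-- A pushdown automaton with one stack letter that simulates a finite automaton and keeps the sum
of the integers attached to the letters read: its sign in the state, its absolute value on the
stack. It accepts, in the state `none`, when the simulated automaton accepts and the sum is zero. -/
def DFA.counterAutomaton {X : Type u} {σ : Type} (M : DFA X σ) (c : X → ℤ) :
    PushdownAutomaton X Unit (Option (σ × Bool)) where
  trans s a t := match s, a, t with
    | some (s, b), some a, some _ =>
      {(some (M.step s a, b), List.replicate (signedValue b 1 * c a + 1).toNat ())}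
    | some (s, _), some a, none =>
      {(some (M.step s a, decide (0 ≤ c a)), List.replicate (c a).natAbs ())}
    | some (s, _), none, none => {d | s ∈ M.accept ∧ d = (none, [])}
    | _, _, _ => ∅
  finite_trans s a t := by
    rcases s with _ | ⟨s, b⟩ <;> rcases a with _ | a <;> rcases t with _ | t <;> simp
    exact (Set.finite_singleton (none, [])).subset fun d hd => hd.2
  start := some (M.start, true)
  initStack := []
  accept := {none}

/-- The `+ 1` restores the stack letter popped by the move; `|c| ≤ 1` keeps `toNat` from truncating.
-/
theorem signedValue_tail (b : Bool) (k : ℕ) {c : ℤ} (hc : |c| ≤ 1) :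
    signedValue b ((signedValue b 1 * c + 1).toNat + k) = signedValue b (k + 1) + c := by
  rw [abs_le] at hc
  cases b <;> simp [signedValue] <;> omega

theorem signedValue_natAbs (c : ℤ) : signedValue (decide (0 ≤ c)) c.natAbs = c := by
  rcases le_total 0 c with h | h
  · simp [signedValue, h]
  · rcases h.eq_or_lt with rfl | h'
    · simp [signedValue]
    · simp [signedValue, h'.not_ge, abs_of_neg h']

theorem DFA.counterAutomaton_reaches_iff {X : Type u} {σ : Type} (M : DFA X σ) {c : X → ℤ}
    (hc : ∀ a, |c a| ≤ 1) (w : List X) (s : σ) (b : Bool) (γ : List Unit) :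
    (∃ γ', Relation.ReflTransGen (M.counterAutomaton c).Step (some (s, b), w, γ) (none, [], γ')) ↔
      M.evalFrom s w ∈ M.accept ∧ signedValue b γ.length + (w.map c).sum = 0 := by
  have hnone : ∀ w γ d, ¬ (M.counterAutomaton c).Step (none, w, γ) d := by
    rintro w γ d ⟨a, v, -, h, -⟩
    simp [counterAutomaton] at h
  have hend : ∀ {w : List X} {γ γ' : List Unit},
      Relation.ReflTransGen (M.counterAutomaton c).Step (none, w, γ) (none, [], γ') → w = [] := by
    intro w γ γ' h
    rcases h.cases_head with h | ⟨d, h, -⟩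
    · simp_all
    · exact absurd h (hnone _ _ _)
  induction w generalizing s b γ with
  | nil =>
    constructor
    · rintro ⟨γ', h⟩
      rcases h.cases_head with h | ⟨d, ⟨a, v, h₁, h₂, h₃⟩, h⟩
      · simp at h
      · have ha : a = none := by cases a <;> simp_all
        subst ha
        rcases γ with _ | ⟨_, γ⟩
        · simp only [counterAutomaton, List.head?_nil, Set.mem_ofPred_eq] at h₂
          exact ⟨h₂.1, by simp [signedValue]⟩
        · simp [counterAutomaton] at h₂
    · rintro ⟨h₁, h₂⟩
      have : γ = [] := by
        rw [← List.length_eq_zero_iff]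
        cases b <;> simp [signedValue] at h₂ <;> simp [h₂]
      subst this
      exact ⟨[], .single ⟨none, [], rfl, ⟨h₁, rfl⟩, rfl⟩⟩
  | cons a w ih =>
    -- Away from the dead end `none`, the automaton has exactly one move, and it updates the counter
    -- by `c a`. The sign is chosen afresh whenever the stack is empty.
    have hstep : ∃ b' γ', signedValue b' γ'.length = signedValue b γ.length + c a ∧
        ∀ d, (M.counterAutomaton c).Step (some (s, b), a :: w, γ) d ∧ d.1 ≠ none ↔
          d = (some (M.step s a, b'), w, γ') := by
      rcases γ with _ | ⟨u, γ⟩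
      · refine ⟨decide (0 ≤ c a), List.replicate (c a).natAbs (), ?_, ?_⟩
        · rw [List.length_replicate, signedValue_natAbs]
          simp [signedValue]
        · rintro ⟨d₁, w', δ⟩
          constructor
          · rintro ⟨⟨_ | a', v, h₁, h₂, h₃⟩, hne⟩
            · simp [counterAutomaton] at h₂
              exact absurd h₂.2.1 hne
            · simp [counterAutomaton] at h₁ h₂ h₃
              simp [h₁, h₂, h₃]
          · rintro h
            obtain ⟨rfl, rfl, rfl⟩ : _ ∧ _ ∧ _ := by simpa using h
            exact ⟨⟨some a, _, rfl, rfl, by simp⟩, by simp⟩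
      · refine ⟨b, List.replicate (signedValue b 1 * c a + 1).toNat () ++ γ, ?_, ?_⟩
        · rw [List.length_append, List.length_replicate, signedValue_tail b _ (hc a),
            List.length_cons]
        · rintro ⟨d₁, w', δ⟩
          constructor
          · rintro ⟨⟨_ | a', v, h₁, h₂, h₃⟩, hne⟩
            · simp [counterAutomaton] at h₂
            · simp [counterAutomaton] at h₁ h₂ h₃
              simp [h₁, h₂, h₃]
          · rintro h
            obtain ⟨rfl, rfl, rfl⟩ : _ ∧ _ ∧ _ := by simpa using h
            exact ⟨⟨some a, _, rfl, rfl, by simp⟩, by simp⟩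
    obtain ⟨b', γ', hv, hd⟩ := hstep
    rw [DFA.evalFrom_cons, List.map_cons, List.sum_cons, ← add_assoc, ← hv]
    refine Iff.trans ?_ (ih (M.step s a) b' γ')
    refine exists_congr fun γ'' => ⟨fun h => ?_, fun h => ?_⟩
    · rcases h.cases_head with h | ⟨⟨_ | d, w', δ⟩, h₁, h⟩
      · simp at h
      · obtain rfl := hend h
        obtain ⟨a', v, h₁, h₂, h₃⟩ := h₁
        rcases a' with _ | a' <;> rcases γ with _ | ⟨_, γ⟩ <;> simp [counterAutomaton] at h₁ h₂
      · rwa [← (hd _).1 ⟨h₁, by simp⟩]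
    · exact h.head ((hd _).2 rfl).1

theorem Language.IsRegular.isOneCounter {X : Type u} {L : Language X} (hL : L.IsRegular)
    {c : X → ℤ} (hc : ∀ a, |c a| ≤ 1) :
    Language.IsOneCounter ({w | w ∈ L ∧ (w.map c).sum = 0} : Set (List X)) := by
  obtain ⟨σ, _, M, rfl⟩ := hL
  refine ⟨Unit, Option (σ × Bool), by simp, inferInstance, M.counterAutomaton c, ?_⟩
  ext w
  have := M.counterAutomaton_reaches_iff hc w M.start true []
  simp only [signedValue, List.length_nil, if_true, Nat.cast_zero, zero_add] at this
  refine Iff.trans ?_ this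
  simp only [PushdownAutomaton.accepts]
  exact ⟨fun ⟨s, hs, h⟩ => by obtain rfl : s = none := hs; exact h, fun h => ⟨none, rfl, h⟩⟩

/-! ### Coarse connectedness -/

/-- Every vertex of a shortest walk from `v` to `y` is at least as close to `y` as `v` is, so the
walk stays in the neighbourhood. -/
theorem SimpleGraph.reachable_induce_of_edist_le {V : Type u} {Γ : SimpleGraph V} {Y : Set V}
    {R : ℕ} {v y : V} (hy : y ∈ Y) (h : Γ.edist v y ≤ R) :
    (Γ.induce {v | ∃ y ∈ Y, Γ.edist v y ≤ R}).Reachable ⟨v, y, hy, h⟩ ⟨y, y, hy, by simp⟩ := by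
  classical
  obtain ⟨w, hw⟩ := Γ.exists_walk_of_edist_ne_top (ne_top_of_le_ne_top (ENat.natCast_ne_top R) h)
  have hs : ∀ z ∈ w.support, z ∈ {v | ∃ y ∈ Y, Γ.edist v y ≤ R} := fun z hz => ⟨y, hy, by
    refine (SimpleGraph.edist_le (w.dropUntil z hz)).trans (le_trans ?_ (hw ▸ h))
    exact_mod_cast w.length_dropUntil_le_length hz⟩
  exact ⟨w.induce _ hs⟩

theorem SimpleGraph.exists_edist_mulCayley_le {G : Type u} [Group G] {S : Set G}
    (hS : Subgroup.closure S = ⊤) (g : G) :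
    ∃ k : ℕ, ∀ p, (mulCayley S).edist p (p * g) ≤ k := by
  have hg : g ∈ Subgroup.closure S := hS ▸ Subgroup.mem_top g
  induction hg using Subgroup.closure_induction with
  | mem s hs =>
    refine ⟨1, fun p => ?_⟩
    by_cases h : p = p * s
    · rw [← h]; simp
    · exact SimpleGraph.edist_le
        (SimpleGraph.Adj.toWalk ((mulCayley_adj' S _ _).2 ⟨h, s, hs, .inl rfl⟩))
  | one => exact ⟨0, by simp⟩
  | mul a b _ _ iha ihb =>
    obtain ⟨k, hk⟩ := iha
    obtain ⟨l, hl⟩ := ihb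
    refine ⟨k + l, fun p => ?_⟩
    rw [← mul_assoc, Nat.cast_add]
    exact SimpleGraph.edist_triangle.trans (add_le_add (hk p) (hl _))
  | inv a _ ih =>
    obtain ⟨k, hk⟩ := ih
    exact ⟨k, fun p => by simpa [SimpleGraph.edist_comm] using hk (p * a⁻¹)⟩

/-- A subset of a group is coarsely connected if its points can be joined to a base point by right
multiplications by elements of a finite set, without leaving the subset. -/
theorem isCoarselyConnectedSubset_of_eqvGen {G : Type u} [Group G] {P T : Set G} (hT : T.Finite)
    {b : G} (hb : b ∈ P)
    (h : ∀ p ∈ P, Relation.EqvGen (fun p q => p ∈ P ∧ q ∈ P ∧ p⁻¹ * q ∈ T) p b) :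
    IsCoarselyConnectedSubset P := by
  intro S _ hS
  choose k hk using SimpleGraph.exists_edist_mulCayley_le hS
  obtain ⟨R, hR⟩ := (hT.image k).bddAbove
  refine ⟨R + 1, by omega, ?_⟩
  -- `EqvGen` is reflexive off `P` too, hence the alternative `p = q`.
  have key : ∀ p q, Relation.EqvGen (fun p q => p ∈ P ∧ q ∈ P ∧ p⁻¹ * q ∈ T) p q →
      p = q ∨ ∃ (hp : p ∈ P) (hq : q ∈ P),
        ((SimpleGraph.mulCayley S).induce
          {v | ∃ y ∈ P, (SimpleGraph.mulCayley S).edist v y ≤ (R + 1 : ℕ)}).Reachable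
            ⟨p, p, hp, by simp⟩ ⟨q, q, hq, by simp⟩ := by
    intro p q hpq
    induction hpq with
    | rel p q hpq =>
      obtain ⟨hp, hq, hT⟩ := hpq
      refine .inr ⟨hp, hq, SimpleGraph.reachable_induce_of_edist_le hq ?_⟩
      have h₁ := hk (p⁻¹ * q) p
      rw [mul_inv_cancel_left] at h₁
      refine h₁.trans ?_
      exact_mod_cast (hR ⟨_, hT, rfl⟩).trans (Nat.le_succ R)
    | refl p => exact .inl rfl
    | symm p q _ ih =>
      rcases ih with rfl | ⟨hp, hq, h⟩
      · exact .inl rfl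
      · exact .inr ⟨hq, hp, h.symm⟩
    | trans p q r _ _ ih₁ ih₂ =>
      rcases ih₁ with rfl | ⟨hp, hq, h₁⟩
      · exact ih₂
      rcases ih₂ with rfl | ⟨_, hr, h₂⟩
      · exact .inr ⟨hp, hq, h₁⟩
      · exact .inr ⟨hp, hr, h₁.trans h₂⟩
  refine (SimpleGraph.connected_iff_exists_forall_reachable _).2 ⟨⟨b, b, hb, by simp⟩, ?_⟩
  rintro ⟨v, y, hy, hv⟩
  refine SimpleGraph.Reachable.symm ((SimpleGraph.reachable_induce_of_edist_le hy hv).trans ?_)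
  rcases key y b (h y hy) with rfl | ⟨_, _, h'⟩
  · rfl
  · exact h'

/-! ### The lexicographic cone of a free-by-cyclic group -/

theorem isLeftOrder_of_cone {G : Type u} [Group G] {P : Set G} (hone : 1 ∉ P)
    (hmul : ∀ a ∈ P, ∀ b ∈ P, a * b ∈ P) (htotal : ∀ a, a ∈ P ∨ a = 1 ∨ a⁻¹ ∈ P) :
    IsLeftOrder fun a b : G => a⁻¹ * b ∈ P where
  irrefl a := by simpa using hone
  trans a b c hab hbc := by simpa [mul_assoc] using hmul _ hab _ hbc
  total a b := by
    rcases htotal (a⁻¹ * b) with h | h | h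
    · exact .inl h
    · exact .inr (.inl (inv_mul_eq_one.1 h))
    · exact .inr (.inr (by simpa using h))
  mul_left a b c := by simp [mul_assoc]

theorem positiveCone_of_cone {G : Type u} [Group G] (P : Set G) :
    positiveCone (fun a b : G => a⁻¹ * b ∈ P) = P := by
  ext g; simp [positiveCone]

section Cone

open FreeGroup (weight weight_one weight_inv odd_weight weight_add_le of)

variable {G : Type u} [Group G] (f : G →* Multiplicative ℤ) {n : ℕ} (ψ : FreeGroup (Fin n) →* G)

/-- The pairs `(g, m)` such that `g` has positive image, or lies in the free group with
`weight g + 2 * m` positive. -/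
def lexCone : Set (G × Multiplicative ℤ) :=
  {p | 0 < (f p.1).toAdd ∨ ∃ h, ψ h = p.1 ∧ 0 < weight h + 2 * p.2.toAdd}

variable {f ψ}

theorem isLeftOrder_lexCone (hψ : Function.Injective ψ) (hψf : ∀ g, f g = 1 ↔ ∃ h, ψ h = g) :
    IsLeftOrder fun a b => a⁻¹ * b ∈ lexCone f ψ := by
  have h1 : ∀ h, f (ψ h) = 1 := fun h => (hψf _).2 ⟨h, rfl⟩
  refine isLeftOrder_of_cone ?_ ?_ ?_
  · rintro (h | ⟨h, h', h''⟩)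
    · simp at h
    · obtain rfl : h = 1 := hψ (by simpa using h')
      simp at h''
  · rintro ⟨a, k⟩ ha ⟨b, l⟩ hb
    simp only [lexCone, Set.mem_ofPred_eq, Prod.mk_mul_mk, map_mul, toAdd_mul] at ha hb ⊢
    rcases ha with ha | ⟨u, rfl, hu⟩ <;> rcases hb with hb | ⟨v, rfl, hv⟩
    · left; omega
    · left; simpa [h1] using ha
    · left; simpa [h1] using hb
    · refine .inr ⟨u * v, map_mul _ _ _, ?_⟩
      -- Two positive integers add up to at least `2`, so a defect of `1` leaves the sum positive.
      have := weight_add_le u v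
      omega
  · rintro ⟨a, k⟩
    simp only [lexCone, Set.mem_ofPred_eq, Prod.inv_mk, map_inv, toAdd_inv]
    rcases lt_trichotomy (f a).toAdd 0 with h | h | h
    · exact .inr (.inr (.inl (by omega)))
    · obtain ⟨u, rfl⟩ := (hψf a).1 (Multiplicative.toAdd.injective h)
      rcases lt_trichotomy (weight u + 2 * k.toAdd) 0 with h | h | h
      · exact .inr (.inr (.inr ⟨u⁻¹, map_inv _ _, by rw [weight_inv]; omega⟩))
      -- By parity: an odd weight cannot cancel the even central term.
      · have hu : u = 1 := by
          by_contra hu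
          have := (odd_weight hu).add_even (even_two_mul k.toAdd)
          simp [h] at this
        subst hu
        refine .inr (.inl (Prod.ext (map_one _) (Multiplicative.toAdd.injective ?_)))
        simpa using h
      · exact .inl (.inr ⟨u, rfl, h⟩)
    · exact .inl (.inl h)

theorem isLexLedByQuotient_lexCone (hψ : Function.Injective ψ) (hψf : ∀ g, f g = 1 ↔ ∃ h, ψ h = g) :
    IsLexLedByQuotient f fun a b => ((a, 1) : G × Multiplicative ℤ)⁻¹ * (b, 1) ∈ lexCone f ψ := by
  have hlt := (isLeftOrder_lexCone hψ hψf).comap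
    (ψ := MonoidHom.inl G (Multiplicative ℤ)) fun _ _ h => (Prod.mk.inj h).1
  refine ⟨hlt, _, fun a b => a.toAdd < b.toAdd, hlt.comap f.ker.subtype_injective, ?_, ?_⟩
  · exact ⟨fun a => lt_irrefl _, fun a b c => lt_trans, fun a b => lt_trichotomy a.toAdd b.toAdd,
      fun a b c => by simp⟩
  · ext g
    simp only [positiveCone, Set.mem_union, Set.mem_preimage, Set.mem_image, Set.mem_ofPred_eq,
      lexCone]
    refine or_congr ?_ ⟨?_, ?_⟩
    · simp
    · rintro ⟨h, hh, hw⟩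
      refine ⟨⟨g, (hψf g).2 ⟨h, by simpa using hh⟩⟩, ?_, rfl⟩
      exact .inr ⟨h, by simpa using hh, by simpa using hw⟩
    · rintro ⟨⟨a, ha⟩, h, rfl⟩
      rcases h with h | ⟨h, hh, hw⟩
      · rw [MonoidHom.mem_ker] at ha
        simp [ha] at h
      · exact ⟨h, by simpa using hh, by simpa using hw⟩

/-- Elements of positive image lie in the cone whatever their free part, so one can move freely
inside each such coset of the kernel and between cosets along powers of `t`. Positive kernel
elements enter this region after one multiplication by `t`. -/
theorem isCoarselyConnectedSubset_lexCone (hψf : ∀ g, f g = 1 ↔ ∃ h, ψ h = g) {t : G}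
    (ht : (f t).toAdd = 1) :
    IsCoarselyConnectedSubset {g : G | (g, 1) ∈ lexCone f ψ} := by
  have hP : ∀ g, 0 < (f g).toAdd → g ∈ {g : G | (g, 1) ∈ lexCone f ψ} := fun g hg => .inl hg
  have h1 : ∀ h, f (ψ h) = 1 := fun h => (hψf _).2 ⟨h, rfl⟩
  refine isCoarselyConnectedSubset_of_eqvGen (T := insert t (Set.range fun i => ψ (of i)))
    (Set.finite_range _ |>.insert _) (hP t (by omega)) ?_
  set r : G → G → Prop := fun p q => p ∈ {g : G | (g, 1) ∈ lexCone f ψ} ∧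
    q ∈ {g : G | (g, 1) ∈ lexCone f ψ} ∧ p⁻¹ * q ∈ insert t (Set.range fun i => ψ (of i)) with hr
  have hfree : ∀ (u : FreeGroup (Fin n)) (p : G), 0 < (f p).toAdd →
      Relation.EqvGen r p (p * ψ u) := by
    intro u
    have hof : ∀ (i : Fin n) (p : G), 0 < (f p).toAdd → Relation.EqvGen r p (p * ψ (of i)) :=
      fun i p hp => .rel _ _ ⟨hP _ hp, hP _ (by simpa [h1] using hp), .inr ⟨i, by simp⟩⟩
    induction u using FreeGroup.induction_on with
    | C1 => exact fun p _ => by simpa using .refl p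
    | of i => exact hof i
    | inv_of i _ =>
      intro p hp
      refine .symm _ _ ?_
      simpa using hof i (p * ψ (of i)⁻¹) (by simpa [h1] using hp)
    | mul u v hu hv =>
      intro p hp
      rw [map_mul, ← mul_assoc]
      exact .trans _ _ _ (hu p hp) (hv _ (by simpa [h1] using hp))
  have hpow : ∀ k : ℕ, Relation.EqvGen r (t ^ (k + 1)) t := by
    intro k
    induction k with
    | zero => simpa using .refl t
    | succ k ih =>
      refine .trans _ _ _ (.symm _ _ (.rel _ _ ⟨hP _ ?_, hP _ ?_, .inl ?_⟩)) ih
      · simp [ht]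
      · simp [ht]
        omega
      · rw [pow_succ t (k + 1)]; simp
  have hpos : ∀ p : G, 0 < (f p).toAdd → Relation.EqvGen r p t := by
    intro p hp
    obtain ⟨k, hk⟩ : ∃ k : ℕ, (f p).toAdd = k + 1 := ⟨((f p).toAdd - 1).toNat, by omega⟩
    obtain ⟨u, hu⟩ := (hψf ((t ^ (k + 1))⁻¹ * p)).1
      (Multiplicative.toAdd.injective (by simp [ht, hk]))
    have := hfree u (t ^ (k + 1)) (by simp [ht])
    rw [hu, mul_inv_cancel_left] at this
    exact .trans _ _ _ (.symm _ _ this) (hpow k)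
  intro p hp
  rcases id hp with h | ⟨u, hu, -⟩
  · exact hpos p h
  · have hpt : 0 < (f (p * t)).toAdd := by
      simp only at hu
      simp [← hu, h1, ht]
    exact .trans _ _ _ (.rel _ _ ⟨hp, hP _ hpt, .inl (by simp)⟩) (hpos _ hpt)

end Cone

/-! ### A regular language for the lexicographic cone -/

section ConeLanguage

open FreeGroup (weight wordWeight wordWeight_cons turnSign letterCode letterCode_add_ne_zero
  letterCode_ne_zero sign_cases IsReduced isReduced_toWord mk_toWord isReduced_cons_cons)

variable {G : Type u} [Group G] (f : G →* Multiplicative ℤ) {n : ℕ} (ψ : FreeGroup (Fin n) →* G)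
  (t : G)

/-- The letters used to represent the cone: those of the first kind represent the elements of
positive image, those of the second kind the elements with free first component. -/
abbrev ConeLetter (n : ℕ) : Type :=
  (Option (Fin n × Bool) × SignType × SignType) ⊕ (Option (Fin n × Bool) × SignType)

/-- The free letter in a letter, if any. -/
def optionLetter (o : Option (Fin n × Bool)) : FreeGroup (Fin n) :=
  FreeGroup.mk o.toList

/-- The element represented by a letter. -/
def coneValue : ConeLetter n → G × Multiplicative ℤ
  | .inl (o, a, c) => (ψ (optionLetter o) * t ^ (a : ℤ), Multiplicative.ofAdd (c : ℤ))
  | .inr (o, c) => (ψ (optionLetter o), Multiplicative.ofAdd (c : ℤ))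

/-- The letters allowed at the beginning of a word. -/
def ConeStart : ConeLetter n → Prop
  | .inl (_, a, _) => a = 1
  | .inr (some x, c) => (letterCode x).sign + 2 * (c : ℤ) = 1
  | .inr (none, c) => c = 1

/-- The pairs of letters allowed at consecutive places of a word: in words of the second kind, the
weight of the free letters read is balanced by the central component. -/
def ConeStep : ConeLetter n → ConeLetter n → Prop
  | .inl _, .inl (_, a, _) => 0 ≤ a
  | .inr (some x, _), .inr (some y, c) => (x.1 = y.1 → x.2 = y.2) ∧
      2 * (c : ℤ) = -((letterCode y).sign + (letterCode x + letterCode y).sign)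
  | .inr _, .inr (none, c) => c = 1
  | _, _ => False

theorem map_mk_cons (x : Fin n × Bool) (l : List (Fin n × Bool)) :
    ψ (FreeGroup.mk (x :: l)) = ψ (FreeGroup.mk [x]) * ψ (FreeGroup.mk l) := by
  rw [← map_mul, FreeGroup.mul_mk]
  rfl

/-- The word spells the power of `t`, then the free part, then the central part. Arbitrary `k`
serves surjectivity of evaluation; `k > 0` serves the cone. -/
theorem exists_inl_word {ψ : FreeGroup (Fin n) →* G} {t : G}
    (k m : ℤ) (h : FreeGroup (Fin n)) :
    ∃ w : List (ConeLetter n), evalWord (coneValue ψ t) w =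
        (t ^ k * ψ h, Multiplicative.ofAdd m) ∧
      (∀ b ∈ w, ∃ o c, b = .inl (o, SignType.sign k, c) ∨ b = .inl (o, 0, c)) ∧
      (0 < k → ∃ a ∈ w.head?, ConeStart a) := by
  have hfree : ∀ l : List (Fin n × Bool),
      evalWord (coneValue ψ t) (l.map fun x => .inl (some x, 0, 0)) = (ψ (FreeGroup.mk l), 1) := by
    intro l
    induction l with
    | nil => rw [← FreeGroup.one_eq_mk, map_one]; rfl
    | cons x l ih =>
      rw [List.map_cons, evalWord_cons, ih, map_mk_cons]
      simp [coneValue, optionLetter]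
  have hpow : ∀ (b : ConeLetter n) (j : ℕ),
      evalWord (coneValue ψ t) (List.replicate j b) = coneValue ψ t b ^ j := fun b j => by
    simp [evalWord]
  have hsign : ∀ j : ℤ, (SignType.sign j : ℤ) * j.natAbs = j := fun j => by
    rw [Int.natCast_natAbs, sign_mul_abs]
  refine ⟨List.replicate k.natAbs (.inl (none, SignType.sign k, 0)) ++
    (h.toWord.map fun x => .inl (some x, 0, 0)) ++
    List.replicate m.natAbs (.inl (none, 0, SignType.sign m)), ?_, ?_, ?_⟩
  · rw [evalWord_append, evalWord_append, hfree, hpow, hpow, mk_toWord]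
    simp only [coneValue, optionLetter, Option.toList_none, ← FreeGroup.one_eq_mk, map_one, one_mul,
      SignType.coe_zero, ofAdd_zero, Prod.pow_mk, Prod.mk_mul_mk, mul_one, zpow_zero,
      ← zpow_natCast, ← zpow_mul, hsign, ← ofAdd_zsmul, smul_eq_mul]
    rw [mul_comm _ (SignType.sign m : ℤ), hsign, one_zpow, one_zpow, mul_one, one_mul]
  · simp only [List.mem_append, List.mem_replicate, List.mem_map]
    rintro b ((⟨-, rfl⟩ | ⟨x, -, rfl⟩) | ⟨-, rfl⟩)
    · exact ⟨_, _, .inl rfl⟩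
    · exact ⟨_, _, .inr rfl⟩
    · exact ⟨_, _, .inr rfl⟩
  · intro hk
    obtain ⟨j, hj⟩ : ∃ j, k.natAbs = j + 1 := ⟨k.natAbs - 1, by omega⟩
    refine ⟨.inl (none, SignType.sign k, 0), by simp [hj, List.replicate_succ], ?_⟩
    exact sign_pos hk

theorem evalWord_inl_nonneg {f : G →* Multiplicative ℤ} {ψ : FreeGroup (Fin n) →* G} {t : G}
    (ht : (f t).toAdd = 1) (h1 : ∀ h, f (ψ h) = 1) (w : List (ConeLetter n))
    (p : Option (Fin n × Bool) × SignType × SignType) (hw : (.inl p :: w).IsChain ConeStep) :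
    0 ≤ (f (evalWord (coneValue ψ t) w).1).toAdd := by
  induction w generalizing p with
  | nil => simp
  | cons b w ih =>
    rw [List.isChain_cons_cons] at hw
    rcases b with ⟨o, a, c⟩ | b
    · have h₁ := ih _ hw.2
      have h₂ : 0 ≤ a := hw.1
      have h₃ : (0 : ℤ) ≤ a := by revert h₂; cases a <;> decide
      rw [evalWord_cons, Prod.fst_mul, map_mul, toAdd_mul]
      simp only [coneValue, map_mul, h1, one_mul, map_zpow, toAdd_zpow, ht, smul_eq_mul, mul_one]
      omega
    · exact hw.1.elim

theorem evalWord_inr_none {ψ : FreeGroup (Fin n) →* G} {t : G} (w : List (ConeLetter n))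
    (c : SignType) (hw : (.inr (none, c) :: w).IsChain ConeStep) :
    ∃ j : ℕ, evalWord (coneValue ψ t) w = (1, Multiplicative.ofAdd (j : ℤ)) := by
  induction w generalizing c with
  | nil => exact ⟨0, rfl⟩
  | cons b w ih =>
    rw [List.isChain_cons_cons] at hw
    rcases b with b | ⟨_ | x, d⟩
    · exact hw.1.elim
    · obtain ⟨j, hj⟩ := ih _ hw.2
      obtain rfl : d = 1 := hw.1
      refine ⟨j + 1, ?_⟩
      rw [evalWord_cons, hj]
      simp [coneValue, optionLetter, ← FreeGroup.one_eq_mk, ← ofAdd_add, add_comm]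
    · exact hw.1.elim

/-- Each further free letter leaves weight plus twice the central part unchanged, by `ConeStep`;
trailing central letters only raise it. -/
theorem evalWord_inr_some {ψ : FreeGroup (Fin n) →* G} {t : G} (w : List (ConeLetter n))
    (x : Fin n × Bool) (c : SignType) (hw : (.inr (some x, c) :: w).IsChain ConeStep) :
    ∃ (u : List (Fin n × Bool)) (m : ℤ), evalWord (coneValue ψ t) (.inr (some x, c) :: w) =
        (ψ (FreeGroup.mk (x :: u)), Multiplicative.ofAdd m) ∧ IsReduced (x :: u) ∧
      (letterCode x).sign + 2 * (c : ℤ) ≤ wordWeight (x :: u) + 2 * m := by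
  induction w generalizing x c with
  | nil => exact ⟨[], c, by simp [coneValue, optionLetter], by simp, by simp [wordWeight]⟩
  | cons b w ih =>
    rw [List.isChain_cons_cons] at hw
    rcases b with b | ⟨_ | y, d⟩
    · exact hw.1.elim
    · obtain ⟨j, hj⟩ := evalWord_inr_none (ψ := ψ) (t := t) w d hw.2
      obtain rfl : d = 1 := hw.1
      refine ⟨[], c + (1 + j), ?_, by simp, ?_⟩
      · rw [evalWord_cons, evalWord_cons, hj]
        simp [coneValue, optionLetter, ← FreeGroup.one_eq_mk, ← ofAdd_add]
      · simp only [wordWeight]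
        omega
    · obtain ⟨u, m, hu, hr, hm⟩ := ih y d hw.2
      obtain ⟨hxy, hd⟩ := hw.1
      refine ⟨y :: u, c + m, ?_, isReduced_cons_cons.2 ⟨hxy, hr⟩, ?_⟩
      · rw [evalWord_cons, hu, map_mk_cons ψ x]
        simp [coneValue, optionLetter, ← ofAdd_add]
      · simp only [wordWeight]
        omega

theorem exists_inr_word {ψ : FreeGroup (Fin n) →* G} {t : G} (u : List (Fin n × Bool))
    (x : Fin n × Bool) (c : SignType) (m : ℤ) (hr : IsReduced (x :: u))
    (hm : (letterCode x).sign + 2 * (c : ℤ) ≤ wordWeight (x :: u) + 2 * m) :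
    ∃ w, (.inr (some x, c) :: w).IsChain ConeStep ∧
      evalWord (coneValue ψ t) (.inr (some x, c) :: w) =
        (ψ (FreeGroup.mk (x :: u)), Multiplicative.ofAdd m) := by
  induction u generalizing x c m with
  | nil =>
    simp only [wordWeight] at hm
    -- The surplus `j` is spelled by trailing central letters.
    obtain ⟨j, hj⟩ : ∃ j : ℕ, m = c + j := ⟨(m - c).toNat, by omega⟩
    subst hj
    refine ⟨List.replicate j (.inr (none, 1)), ?_, ?_⟩
    · have : ∀ (j : ℕ) (o : Option (Fin n × Bool)) (c : SignType),
          (.inr (o, c) :: List.replicate j (.inr (none, 1)) : List (ConeLetter n)).IsChain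
            ConeStep := by
        intro j
        induction j with
        | zero => simp
        | succ j ih =>
          intro o c
          rw [List.replicate_succ, List.isChain_cons_cons]
          exact ⟨by cases o <;> rfl, ih _ _⟩
      exact this _ _ _
    · simp [evalWord, coneValue, optionLetter, ← FreeGroup.one_eq_mk, ← ofAdd_add, ← ofAdd_nsmul]
  | cons y u ih =>
    rw [isReduced_cons_cons] at hr
    -- Both signs are `±1`, so half their sum lies in `{-1, 0, 1}`: one central letter is enough.
    obtain ⟨d, hd⟩ : ∃ d : SignType,
        2 * (d : ℤ) = -((letterCode y).sign + (letterCode x + letterCode y).sign) := by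
      have h₁ := sign_cases (letterCode y)
      have h₂ := sign_cases (letterCode x + letterCode y)
      have h₃ := letterCode_ne_zero y
      have h₄ := letterCode_add_ne_zero hr.1
      rcases h₁ with h₁ | h₁ | h₁ <;> rcases h₂ with h₂ | h₂ | h₂ <;> try omega
      · exact ⟨1, by simp [h₁, h₂]⟩
      · exact ⟨0, by simp [h₁, h₂]⟩
      · exact ⟨0, by simp [h₁, h₂]⟩
      · exact ⟨-1, by simp [h₁, h₂]⟩
    simp only [wordWeight] at hm
    obtain ⟨w, hw, he⟩ := ih y d (m - c) hr.2 (by omega)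
    refine ⟨.inr (some y, d) :: w, List.isChain_cons_cons.2 ⟨⟨hr.1, hd⟩, hw⟩, ?_⟩
    rw [evalWord_cons, he, map_mk_cons ψ x]
    simp [coneValue, optionLetter]

variable {f ψ t}

theorem exists_eq_zpow_mul (hψf : ∀ g, f g = 1 ↔ ∃ h, ψ h = g) (ht : (f t).toAdd = 1) (g : G) :
    ∃ h, g = t ^ (f g).toAdd * ψ h := by
  obtain ⟨h, hh⟩ := (hψf ((t ^ (f g).toAdd)⁻¹ * g)).1
    (Multiplicative.toAdd.injective (by simp [ht]))
  exact ⟨h, by simp [hh]⟩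

theorem surjective_evalWord_coneValue (hψf : ∀ g, f g = 1 ↔ ∃ h, ψ h = g) (ht : (f t).toAdd = 1) :
    Function.Surjective (evalWord (coneValue (n := n) ψ t)) := by
  rintro ⟨g, m⟩
  obtain ⟨h, hh⟩ := exists_eq_zpow_mul hψf ht g
  obtain ⟨w, hw, -⟩ := exists_inl_word (ψ := ψ) (t := t) (f g).toAdd m.toAdd h
  exact ⟨w, by rw [hw, ← hh]; rfl⟩

theorem evalWord_image_localLanguage (hψf : ∀ g, f g = 1 ↔ ∃ h, ψ h = g) (ht : (f t).toAdd = 1) :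
    evalWord (coneValue ψ t) '' localLanguage ConeStart ConeStep = lexCone f ψ := by
  have h1 : ∀ h, f (ψ h) = 1 := fun h => (hψf _).2 ⟨h, rfl⟩
  ext ⟨g, m⟩
  constructor
  · rintro ⟨_ | ⟨b, w⟩, ⟨⟨a, ha, hI⟩, hw⟩, he⟩
    · simp at ha
    obtain rfl : b = a := by simpa using ha
    rcases b with ⟨o, a, c⟩ | ⟨_ | x, c⟩
    · obtain rfl : a = 1 := hI
      have h₁ := evalWord_inl_nonneg ht h1 w _ hw
      left
      rw [← he, evalWord_cons, Prod.fst_mul, map_mul, toAdd_mul]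
      simp only [coneValue, map_mul, h1, one_mul, map_zpow, toAdd_zpow, ht, smul_eq_mul, mul_one,
        SignType.coe_one]
      omega
    · obtain rfl : c = 1 := hI
      obtain ⟨j, hj⟩ := evalWord_inr_none (ψ := ψ) (t := t) w _ hw
      refine .inr ⟨1, ?_, ?_⟩
      · rw [← he, evalWord_cons, hj]
        simp [coneValue, optionLetter, ← FreeGroup.one_eq_mk]
      · rw [← he, evalWord_cons, hj]
        simp [coneValue]
        omega
    · obtain ⟨u, k, hu, hr, hk⟩ := evalWord_inr_some (ψ := ψ) (t := t) w x c hw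
      have hI' : (letterCode x).sign + 2 * (c : ℤ) = 1 := hI
      rw [hu] at he
      rw [← he]
      refine .inr ⟨FreeGroup.mk (x :: u), rfl, ?_⟩
      rw [weight, FreeGroup.toWord_mk, hr.reduce_eq]
      simp only [toAdd_ofAdd]
      omega
  · rintro (hg | ⟨h, hh, hm⟩)
    · obtain ⟨h, hh⟩ := exists_eq_zpow_mul hψf ht g
      obtain ⟨w, hw, hb, hs⟩ := exists_inl_word (ψ := ψ) (t := t) (f g).toAdd m.toAdd h
      refine ⟨w, ⟨hs hg, ?_⟩, by rw [hw, ← hh]; rfl⟩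
      refine (List.pairwise_of_forall_mem_list fun a ha b hb' => ?_).isChain
      obtain ⟨o, c, h₁⟩ := hb a ha
      obtain ⟨o', c', h₂⟩ := hb b hb'
      have h₃ : 0 ≤ SignType.sign (f g).toAdd := by rw [sign_pos hg]; decide
      rcases h₁ with rfl | rfl <;> rcases h₂ with rfl | rfl <;> first | exact h₃ | exact le_rfl
    · simp only at hh hm
      subst hh
      rcases hw : h.toWord with _ | ⟨x, u⟩
      · obtain rfl : h = 1 := FreeGroup.toWord_eq_nil_iff.1 hw
        obtain ⟨j, hj⟩ : ∃ j : ℕ, m.toAdd = j + 1 :=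
          ⟨(m.toAdd - 1).toNat, by rw [FreeGroup.weight_one] at hm; omega⟩
        refine ⟨List.replicate (j + 1) (.inr (none, 1)), ⟨⟨.inr (none, 1), ?_, rfl⟩, ?_⟩, ?_⟩
        · simp [List.replicate_succ]
        · exact List.isChain_replicate_of_rel _ rfl
        · have : m = Multiplicative.ofAdd (j + 1 : ℤ) := hj
          simp [evalWord, coneValue, optionLetter, ← FreeGroup.one_eq_mk, this, ← ofAdd_nsmul]
      · have hr : IsReduced (x :: u) := hw ▸ isReduced_toWord
        -- The balance starts at `1`, the least positive value, so every positive total can be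
        -- reached by a nonnegative surplus.
        obtain ⟨c, hc⟩ : ∃ c : SignType, (letterCode x).sign + 2 * (c : ℤ) = 1 := by
          rcases sign_cases (letterCode x) with h | h | h
          · exact ⟨1, by simp [h]⟩
          · exact absurd h.1 (letterCode_ne_zero x)
          · exact ⟨0, by simp [h]⟩
        rw [weight, hw] at hm
        obtain ⟨w, hw', he⟩ := exists_inr_word (ψ := ψ) (t := t) u x c m.toAdd hr (by omega)
        exact ⟨_, ⟨⟨.inr (some x, c), rfl, hc⟩, hw'⟩, by rw [he, ← hw, mk_toWord]; rfl⟩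

theorem abs_coneValue_snd_le (b : ConeLetter n) : |(coneValue ψ t b).2.toAdd| ≤ 1 := by
  have : ∀ c : SignType, |(c : ℤ)| ≤ 1 := by decide
  rcases b with ⟨o, a, c⟩ | ⟨o, c⟩ <;> exact this c

/-- A free-by-infinite cyclic group carries a lexicographic left-order that is one-counter, has a
coarsely connected positive cone, and extends to a regular left-order on the product with `ℤ`. -/
theorem exists_isOneCounterLeftOrder (hf : Function.Surjective f) (e : f.ker ≃* FreeGroup (Fin n)) :
    ∃ lt : G → G → Prop, IsLexLedByQuotient f lt ∧ IsOneCounterLeftOrder lt ∧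
      IsCoarselyConnectedSubset (positiveCone lt) ∧
      ∃ lt' : G × Multiplicative ℤ → G × Multiplicative ℤ → Prop,
        IsRegularLeftOrder lt' ∧ ExtendsLeftFactor lt' lt := by
  let ψ : FreeGroup (Fin n) →* G := f.ker.subtype.comp e.symm.toMonoidHom
  have hψ : Function.Injective ψ := f.ker.subtype_injective.comp e.symm.injective
  have hψf : ∀ g, f g = 1 ↔ ∃ a, ψ a = g := fun g =>
    ⟨fun hg => ⟨e ⟨g, hg⟩, by simp [ψ]⟩, by rintro ⟨a, rfl⟩; exact (e.symm a).2⟩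
  obtain ⟨t, ht'⟩ := hf (Multiplicative.ofAdd 1)
  have ht : (f t).toAdd = 1 := by rw [ht']; rfl
  have himage := evalWord_image_localLanguage hψf ht
  have hsurj := surjective_evalWord_coneValue hψf ht
  have hreg := isRegular_localLanguage (ConeStart (n := n)) ConeStep
  have hlex := isLexLedByQuotient_lexCone hψ hψf
  have hcone : positiveCone (fun a b => ((a, 1) : G × Multiplicative ℤ)⁻¹ * (b, 1) ∈ lexCone f ψ) =
      {g : G | (g, 1) ∈ lexCone f ψ} := by
    ext g; simp [positiveCone]
  have hfst : ∀ w, evalWord (fun b => (coneValue ψ t b).1) w = (evalWord (coneValue ψ t) w).1 :=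
    fun w => (map_evalWord _ (MonoidHom.fst G (Multiplicative ℤ)) w).symm
  have hsnd : ∀ w, (w.map fun b => (coneValue ψ t b).2.toAdd).sum =
      (evalWord (coneValue ψ t) w).2.toAdd := by
    intro w
    induction w with
    | nil => rfl
    | cons b w ih => rw [List.map_cons, List.sum_cons, ih, evalWord_cons]; rfl
  -- The same letters and regular language serve both orders: for `G` the central coordinate is
  -- dropped from the value and becomes the counter, required to end at `0`.
  refine ⟨_, hlex, ⟨hlex.1, ConeLetter n, inferInstance, fun b => (coneValue ψ t b).1, ?_, _,
    hreg.isOneCounter (c := fun b => (coneValue ψ t b).2.toAdd) abs_coneValue_snd_le, ?_⟩, ?_, _,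
    ⟨isLeftOrder_lexCone hψ hψf, ConeLetter n, inferInstance, coneValue ψ t, hsurj, _, hreg, ?_⟩,
    fun a b => Iff.rfl⟩
  · intro g
    obtain ⟨w, hw⟩ := hsurj (g, 1)
    exact ⟨w, by rw [hfst, hw]⟩
  · rw [hcone, ← himage]
    ext g
    constructor
    · rintro ⟨w, ⟨hw, hc⟩, rfl⟩
      rw [hsnd] at hc
      exact ⟨w, hw, Prod.ext (hfst w).symm (Multiplicative.toAdd.injective hc)⟩
    · rintro ⟨w, hw, he⟩
      exact ⟨w, ⟨hw, by rw [hsnd, he]; rfl⟩, by rw [hfst, he]⟩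
  · rw [hcone]
    exact isCoarselyConnectedSubset_lexCone hψf ht
  · rw [positiveCone_of_cone, himage]

end ConeLanguage

theorem mainTheorem5 {G : Type u} [Group G] (f : G →* Multiplicative ℤ)
    (hf : Function.Surjective f) (n : ℕ) (hn : 2 ≤ n)
    (hker : Nonempty (f.ker ≃* FreeGroup (Fin n))) :
    (∀ lt : G → G → Prop, IsLexLedByQuotient f lt → ¬ IsRegularLeftOrder lt) ∧
    (∃ lt : G → G → Prop, IsLexLedByQuotient f lt ∧ IsOneCounterLeftOrder lt ∧
      IsCoarselyConnectedSubset (positiveCone lt) ∧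
      ∃ lt' : G × Multiplicative ℤ → G × Multiplicative ℤ → Prop,
        IsRegularLeftOrder lt' ∧ ExtendsLeftFactor lt' lt) := by
  obtain ⟨e⟩ := hker
  exact ⟨fun lt hlt => hlt.not_isRegularLeftOrder hf hn e, exists_isOneCounterLeftOrder hf e⟩
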